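/- Let $p$ be a prime, let $k$ be a perfect commutative ring of characteristic $p$, and let $m,e$ be positive integers. Put $k[\mathbf v_m]=k[X_1,\ldots,X_e]/(X_1^{p^m},\ldots,X_e^{p^m})$ and $I=\{0,\ldots,p^m-1\}^e$, so that the monomials $\mathbf v^{\mathbf i}$ $(\mathbf i\in I)$ form a basis of $k[\mathbf v_m]$. Let $\mathfrak g$ be a group scheme over $k$ with underlying scheme $\operatorname{Spec}k[\mathbf v_m]$, i.e. a Hopf algebra structure on $k[\mathbf v_m]$, with comultiplication $\Delta(\mathbf v^{\mathbf l})=\sum_{\mathbf i,\mathbf j\in I}c_{\mathbf i,\mathbf j}^{\mathbf l}\,\mathbf v^{\mathbf i}\otimes\mathbf v^{\mathbf j}$. A $\mathfrak g$-field $(K,\mathbb D)$ is a field $K$ which is a $k$-algebra, together with an action of $\mathfrak g$ on $\operatorname{Spec}K$ over $k$, i.e. a counital and coassociative $k$-algebra homomorphism $\mathbb D\colon K\to k[\mathbf v_m]\otimes_kK=K[\mathbf v_m]$; write $\mathbb D(r)=\sum_{\mathbf i\in I}D_{\mathbf i}(r)\mathbf v^{\mathbf i}$. An extension of $\mathfrak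 g$-fields is an extension of fields (and of $k$-algebras) compatible with the operators $D_{\mathbf i}$. The $\mathfrak g$-field $(K,\mathbb D)$ is existentially closed if every quantifier-free formula with parameters from $K$, in the language of $k$-algebras (with constants for the elements of $k$) with unary function symbols $D_{\mathbf i}$ $(\mathbf i\in I)$, which has a solution in some $\mathfrak g$-field extension of $(K,\mathbb D)$ has a solution in $(K,\mathbb D)$. Let $\Omega$ be an algebraic closure of $K$. A $K$-variety in $\mathbb A^n$ is the set of common zeros in $\Omega^n$ of a set of polynomials over $K$, not necessarily irreducible; it is $K$-irreducible if it is non-empty and not the union of two proper $K$-subvarieties. For a $K$-variety $V\subseteq\mathbb A^n$ let $I_K(V)$ be the ideal of polynomials over $K$ vanishing on $V$. Its prolongation $\nabla(V)\subseteq\mathbb A^{n|I|}$ consists of those $(x_{s,\mathbf i})_{1\le s\le n,\ \mathbf i\in I}$ for which $\big(\sum_{\mathbf i}x_{s,\mathbf i}\mathbf v^{\mathbf i}\big)_{s}\in\Omega[\mathbf v_m]^n$ is a zero of every $f\in I_K(V)$, where $\Omega[\mathbf v_m]$ is regarded as a $K$-algebra via $K\xrightarrow{\mathbb D}K[\mathbf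 v_m]\subseteq\Omega[\mathbf v_m]$. Let $\mathbb D_V\colon V(K)\to\nabla(V)(K)$ be the map $(a_s)_s\mapsto(D_{\mathbf i}(a_s))_{s,\mathbf i}$, and let $c_V\colon\nabla(V)\to\nabla(\nabla(V))$ be the map $(b_{s,\mathbf l})_{s,\mathbf l}\mapsto\big(\sum_{\mathbf l\in I}c_{\mathbf i,\mathbf j}^{\mathbf l}b_{s,\mathbf l}\big)_{(s,\mathbf i),\mathbf j}$. A $K$-variety $W\subseteq\nabla(V)$ projects generically onto $V$ if the image of $W$ under $(x_{s,\mathbf i})\mapsto(x_{s,\mathbf 0})_s$ is Zariski dense (over $K$) in $V$. **Theorem.** A $\mathfrak g$-field $(K,\mathbb D)$ is existentially closed if and only if it satisfies the following geometric axioms: for every positive integer $n$, all $K$-irreducible $K$-varieties $V\subseteq\mathbb A^n$ and $W\subseteq\nabla(V)$, and every proper $K$-subvariety $Z$ of $W$, if $W$ projects generically onto $V$ and $c_V(W)\subseteq\nabla(W)$, then there is $a\in V(K)$ such that $\mathbb D_V(a)\in W(K)\setminus Z(K)$. -/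

import Mathlib

open scoped TensorProduct

universe u

noncomputable section

/-! ## Truncated polynomial rings -/

/-- The truncated polynomial ring `k[X_1, …, X_e] / (X_1 ^ N, …, X_e ^ N)`; for `N = p ^ m` this is
the ring `k[v_m]`. -/
abbrev TruncPoly (k : Type*) [CommRing k] (e N : ℕ) : Type _ :=
  MvPolynomial (Fin e) k ⧸
    Ideal.span (Set.range fun i : Fin e => (MvPolynomial.X i : MvPolynomial (Fin e) k) ^ N)

/-- The index set `{0, …, N - 1} ^ e` of the monomial basis of `TruncPoly k e N`. -/
abbrev MultiIdx (e N : ℕ) : Type := Fin e → Fin N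

/-- A multi-index as an exponent vector. -/
def MultiIdx.toFinsupp {e N : ℕ} (i : MultiIdx e N) : Fin e →₀ ℕ :=
  Finsupp.equivFunOnFinite.symm fun s => (i s : ℕ)

/-- The class of the monomial `X ^ i` in `TruncPoly k e N`. -/
def TruncPoly.mon (k : Type*) [CommRing k] {e N : ℕ} (i : MultiIdx e N) : TruncPoly k e N :=
  Ideal.Quotient.mk _ (MvPolynomial.monomial i.toFinsupp 1)

/-- Coefficients at exponents with all entries `< N` vanish on the ideal `(X_1 ^ N, …, X_e ^ N)`. -/
theorem TruncPoly.coeff_eq_zero {k : Type*} [CommRing k] {e N : ℕ} (i : MultiIdx e N)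
    {f : MvPolynomial (Fin e) k}
    (hf : f ∈ Ideal.span
      (Set.range fun s : Fin e => (MvPolynomial.X s : MvPolynomial (Fin e) k) ^ N)) :
    MvPolynomial.coeff i.toFinsupp f = 0 := by
  classical
  have hset : (Set.range fun s : Fin e => (MvPolynomial.X s : MvPolynomial (Fin e) k) ^ N) =
      (fun t => MvPolynomial.monomial t (1 : k)) ''
        (Set.range fun s : Fin e => Finsupp.single s N) := by
    ext g
    simp [MvPolynomial.X_pow_eq_monomial]
  rw [hset, MvPolynomial.mem_ideal_span_monomial_image] at hf
  by_contra hne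
  obtain ⟨_, ⟨s, rfl⟩, hs⟩ := hf _ (MvPolynomial.mem_support_iff.mpr hne)
  have h1 := hs s
  have h2 := (i s).isLt
  simp [MultiIdx.toFinsupp] at h1
  omega

/-- The coefficient of the monomial `X ^ i`, as a linear functional on `TruncPoly k e N`. -/
def TruncPoly.coeff (k : Type*) [CommRing k] {e N : ℕ} (i : MultiIdx e N) :
    TruncPoly k e N →ₗ[k] k :=
  (Submodule.liftQ
      ((Ideal.span (Set.range fun s : Fin e =>
        (MvPolynomial.X s : MvPolynomial (Fin e) k) ^ N)).restrictScalars k)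
      (MvPolynomial.lcoeff k i.toFinsupp)
      fun _ hf => TruncPoly.coeff_eq_zero i hf).comp
    (Submodule.Quotient.restrictScalarsEquiv k _).symm.toLinearMap

/-! ## Group scheme actions

A group scheme `𝔤` over `k` with underlying scheme `Spec k[v_m]` is a commutative Hopf algebra `H`
over `k` together with an isomorphism of `k`-algebras `φ : H ≃ₐ[k] TruncPoly k e N`, `N = p ^ m`. -/

/-- A `𝔤`-derivation on a `k`-algebra `R`, where `𝔤 = Spec H`: an action of `𝔤` on `Spec R` over
`k`, that is, a `k`-algebra homomorphism `R → H ⊗[k] R` which is counital and coassociative. -/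
structure GDerivation (k H R : Type*) [CommRing k] [CommRing H] [HopfAlgebra k H]
    [CommRing R] [Algebra k R] where
  /-- the coaction -/
  toAlgHom : R →ₐ[k] H ⊗[k] R
  counit_coaction : ∀ r : R,
    TensorProduct.lid k R ((Coalgebra.counit (R := k) (A := H)).rTensor R (toAlgHom r)) = r
  coassoc : ∀ r : R,
    TensorProduct.assoc k H H R ((Coalgebra.comul (R := k) (A := H)).rTensor R (toAlgHom r)) =
      toAlgHom.toLinearMap.lTensor H (toAlgHom r)

section Coordinates

variable {k H : Type*} [CommRing k] [CommRing H] [HopfAlgebra k H] {e N : ℕ}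
  (φ : H ≃ₐ[k] TruncPoly k e N)

/-- The element `v ^ i` of the Hopf algebra, in the coordinates `φ`. -/
def gMon (i : MultiIdx e N) : H := φ.symm (TruncPoly.mon k i)

/-- The coefficient of `v ^ i`, in the coordinates `φ`. -/
def gCoeff (i : MultiIdx e N) : H →ₗ[k] k := (TruncPoly.coeff k i).comp φ.toLinearMap

/-- The structure constants `c_{i,j}^l` of the comultiplication:
`Δ (v ^ l) = ∑ i j, c_{i,j}^l v ^ i ⊗ v ^ j`. -/
def structConst (i j l : MultiIdx e N) : k :=
  TensorProduct.lid k k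
    (TensorProduct.map (gCoeff φ i) (gCoeff φ j) (Coalgebra.comul (R := k) (gMon φ l)))

/-- The operators `D_i : R → R` of a `𝔤`-derivation `𝔻`: `𝔻 r = ∑ i, v ^ i ⊗ D_i r`. -/
def GDerivation.op {R : Type*} [CommRing R] [Algebra k R] (D : GDerivation k H R)
    (i : MultiIdx e N) (r : R) : R :=
  TensorProduct.lid k R ((gCoeff φ i).rTensor R (D.toAlgHom r))

end Coordinates

/-- `(L, 𝔻')` is a `𝔤`-extension of `(K, 𝔻)`: the structure map `K → L` commutes with the
coactions. -/
def GDerivation.IsExtension {k H K L : Type*} [CommRing k] [CommRing H] [HopfAlgebra k H]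
    [CommRing K] [Algebra k K] [CommRing L] [Algebra k L] [Algebra K L] [IsScalarTower k K L]
    (D : GDerivation k H K) (D' : GDerivation k H L) : Prop :=
  ∀ r : K, D'.toAlgHom (algebraMap K L r) =
    Algebra.TensorProduct.map (AlgHom.id k H) (IsScalarTower.toAlgHom k K L) (D.toAlgHom r)

/-! ## The first-order language and existentially closed `𝔤`-fields -/

/-- Function symbols of the language of `k`-algebras with unary operators `D_i`, `i ∈ ι`. -/
inductive HSFunc (k ι : Type*) : ℕ → Type _
  | zero : HSFunc k ι 0
  | one : HSFunc k ι 0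
  | const (c : k) : HSFunc k ι 0
  | neg : HSFunc k ι 1
  | op (i : ι) : HSFunc k ι 1
  | add : HSFunc k ι 2
  | mul : HSFunc k ι 2

/-- The language of `k`-algebras (with constants for the elements of `k`) with operators `D_i`,
`i ∈ ι`. There are no relation symbols except equality. -/
def hsLanguage (k ι : Type*) : FirstOrder.Language := ⟨HSFunc k ι, fun _ => Empty⟩

/-- A `𝔤`-ring as a structure of the language `hsLanguage`. -/
@[reducible] def GDerivation.toStructure {k H R : Type*} [CommRing k] [CommRing H] [HopfAlgebra k H] {e N : ℕ}
    (φ : H ≃ₐ[k] TruncPoly k e N) [CommRing R] [Algebra k R] (D : GDerivation k H R) :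
    (hsLanguage k (MultiIdx e N)).Structure R where
  funMap := fun {_} f =>
    match f with
    | HSFunc.zero => fun _ => 0
    | HSFunc.one => fun _ => 1
    | HSFunc.const c => fun _ => algebraMap k R c
    | HSFunc.neg => fun x => -x 0
    | HSFunc.op i => fun x => D.op φ i (x 0)
    | HSFunc.add => fun x => x 0 + x 1
    | HSFunc.mul => fun x => x 0 * x 1
  RelMap := fun {_} r _ => nomatch r

/-- The `𝔤`-field `(K, 𝔻)` is existentially closed: every quantifier-free formula over `K` in the
language of `𝔤`-fields (the variables indexed by `K` are the parameters) which has a solution in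
some `𝔤`-field extension of `(K, 𝔻)` has a solution in `(K, 𝔻)`. The extensions range over the
universe of `K`; a solution always lies in an extension which is finitely generated as a field. -/
def GDerivation.IsExistentiallyClosed {k : Type*} {H : Type*} {K : Type u}
    [CommRing k] [CommRing H] [HopfAlgebra k H] {e N : ℕ} (φ : H ≃ₐ[k] TruncPoly k e N)
    [Field K] [Algebra k K] (D : GDerivation k H K) : Prop :=
  ∀ (L : Type u) [Field L] [Algebra k L] [Algebra K L] [IsScalarTower k K L]
    (D' : GDerivation k H L), D.IsExtension D' →
    ∀ (n : ℕ) (ψ : (hsLanguage k (MultiIdx e N)).Formula (K ⊕ Fin n)), ψ.IsQF →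
      (∃ b : Fin n → L,
        @FirstOrder.Language.Formula.Realize _ L (D'.toStructure φ) _ ψ
          (Sum.elim (algebraMap K L) b)) →
      ∃ a : Fin n → K,
        @FirstOrder.Language.Formula.Realize _ K (D.toStructure φ) _ ψ (Sum.elim id a)

/-! ## Varieties over `K`

A (not necessarily irreducible) affine `K`-variety is a `K`-closed set of points over an
algebraically closed extension `Ω` of `K`. -/

section Varieties

variable (K : Type*) {Ω σ : Type*} [Field K] [Field Ω] [Algebra K Ω]

/-- `V` is the set of common zeros of a set of polynomials over `K`. -/
def IsKClosed (V : Set (σ → Ω)) : Prop :=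
  ∃ I : Ideal (MvPolynomial σ K), V = MvPolynomial.zeroLocus Ω I

/-- `V` is a `K`-irreducible `K`-variety. -/
def IsKIrreducible (V : Set (σ → Ω)) : Prop :=
  IsKClosed K V ∧ V.Nonempty ∧
    ∀ V₁ V₂ : Set (σ → Ω), IsKClosed K V₁ → IsKClosed K V₂ → V ⊆ V₁ ∪ V₂ → V ⊆ V₁ ∨ V ⊆ V₂

/-- The closure of a set of points in the Zariski topology over `K`. -/
def kClosure (S : Set (σ → Ω)) : Set (σ → Ω) :=
  MvPolynomial.zeroLocus Ω (MvPolynomial.vanishingIdeal K S)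

end Varieties

/-! ## Prolongations

The affine space `∇ 𝔸^σ` is `𝔸^(σ × ι)`, with `ι = MultiIdx e N`; a point `x` of it with
coordinates in `Ω` corresponds to the point `s ↦ ∑ i, v ^ i ⊗ x (s, i)` of `𝔸^σ` with coordinates
in `𝒟(Ω) = H ⊗[k] Ω = Ω[v_m]`, a `K`-algebra through `𝔻`. -/

section Prolongation

variable {k H : Type*} [CommRing k] [CommRing H] [HopfAlgebra k H] {e N : ℕ}
  (φ : H ≃ₐ[k] TruncPoly k e N)

/-- The ring homomorphism `K → H ⊗[k] K → H ⊗[k] Ω` which makes `𝒟(Ω) = H ⊗[k] Ω` a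
`K`-algebra. -/
def GDerivation.toD {K : Type*} [Field K] [Algebra k K] (D : GDerivation k H K) (Ω : Type*)
    [Field Ω] [Algebra k Ω] [Algebra K Ω] [IsScalarTower k K Ω] : K →+* H ⊗[k] Ω :=
  ((Algebra.TensorProduct.map (AlgHom.id k H) (IsScalarTower.toAlgHom k K Ω)).comp
    D.toAlgHom).toRingHom

/-- The `𝒟(Ω)`-valued point corresponding to `x`. -/
def dPoint {Ω σ : Type*} [Field Ω] [Algebra k Ω] (x : σ × MultiIdx e N → Ω) : σ → H ⊗[k] Ω :=
  fun s => ∑ i : MultiIdx e N, gMon φ i ⊗ₜ[k] x (s, i)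

/-- The prolongation `∇ V`: the points `x` for which the corresponding `𝒟(Ω)`-valued point lies
on `V`, where `V` is taken with its reduced structure over `K`; so `(∇ V)(Ω) = V(𝒟(Ω))`. -/
def GDerivation.nabla {K : Type*} [Field K] [Algebra k K] (D : GDerivation k H K)
    {Ω σ : Type*} [Field Ω] [Algebra k Ω] [Algebra K Ω] [IsScalarTower k K Ω]
    (V : Set (σ → Ω)) : Set (σ × MultiIdx e N → Ω) :=
  {x | ∀ f ∈ MvPolynomial.vanishingIdeal K V,
    MvPolynomial.eval₂ (D.toD Ω) (dPoint φ x) f = 0}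

/-- The map `𝔻_V : V(K) → ∇ V(K)` in coordinates: `a ↦ (D_i a_s)_{s, i}`. -/
def GDerivation.dMap {K : Type*} [Field K] [Algebra k K] (D : GDerivation k H K) {σ : Type*}
    (a : σ → K) : σ × MultiIdx e N → K :=
  fun q => D.op φ q.2 (a q.1)

/-- The map `c_V : ∇ V → ∇ (∇ V)` in coordinates:
`(b_{s, l})_{s, l} ↦ (∑ l, c_{i,j}^l b_{s, l})_{(s, i), j}`. -/
def cMap {Ω σ : Type*} [Field Ω] [Algebra k Ω] (b : σ × MultiIdx e N → Ω) :
    (σ × MultiIdx e N) × MultiIdx e N → Ω :=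
  fun q => ∑ l : MultiIdx e N, structConst φ q.1.2 q.2 l • b (q.1.1, l)

/-- The projection `∇ 𝔸^σ → 𝔸^σ`, `x ↦ x_0`. -/
def nablaProj {Ω σ : Type*} {e N : ℕ} [NeZero N] (x : σ × MultiIdx e N → Ω) : σ → Ω :=
  fun s => x (s, 0)

end Prolongation

/-- The geometric axioms for `(K, 𝔻)`, with the algebraic closure of `K` as the field of
geometric points. -/
def GDerivation.GeometricAxioms {k H K : Type*} [CommRing k] [CommRing H] [HopfAlgebra k H]
    {e N : ℕ} [NeZero N] (φ : H ≃ₐ[k] TruncPoly k e N) [Field K] [Algebra k K]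
    (D : GDerivation k H K) : Prop :=
  ∀ (n : ℕ), 0 < n →
    ∀ (V : Set (Fin n → AlgebraicClosure K))
      (W Z : Set (Fin n × MultiIdx e N → AlgebraicClosure K)),
      IsKIrreducible K V → IsKIrreducible K W → W ⊆ D.nabla φ V →
      IsKClosed K Z → Z ⊂ W →
      -- `W` projects generically onto `V`
      kClosure K (nablaProj '' W) = V →
      -- `c_V (W) ⊆ ∇ W`
      cMap φ '' W ⊆ D.nabla φ W →
      ∃ a : Fin n → K,
        algebraMap K (AlgebraicClosure K) ∘ a ∈ V ∧
        algebraMap K (AlgebraicClosure K) ∘ D.dMap φ a ∈ W \ Z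

end

/-!
The key object is the free `𝔤`-ring `A = K[x_{s,i}]` over `K`, in which `x_{s,i} = D_i x_{s,0}`
(`GDerivation.free`): its coaction is `x_{s,i} ↦ ∑ j, v ^ j ⊗ ∑ l, c_{i,j}^l x_{s,l}`, and it is
coassociative because the comultiplication of `H` is. A tuple `b` in a `𝔤`-extension `L` of `K` is
the same as a morphism of `𝔤`-rings `A → L`, `x_{s,i} ↦ D_i b_s` (`GDerivation.isHom_evalFree`).
Three translations turn the theorem into a statement about prime ideals of `A`.

* `c_V(W) ⊆ ∇ W` says that the ideal `I(W)` of `A` is stable under the operators `D_i`, and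
  `W ⊆ ∇ V` says that the `D_i` map `I(V) ⊆ K[x_{s,0}]` into `I(W)`
  (`cMap_image_subset_nabla_iff`, `subset_nabla_iff`).
* The values of terms at `b` are the images of elements of `A`, so that the truth of a
  quantifier-free formula at `b` depends on which elements of a finite subset of `A` vanish at `b`
  (`exists_finset_realize_iff`); conversely a finite system of equations `f = 0` and an inequation
  `g ≠ 0` with `f, g ∈ A` is a quantifier-free formula (`exists_formula_realize_iff`).
* A stable prime ideal `P` of `A` is the kernel of a morphism to a `𝔤`-field, the field of fractions
  of `A / P` (`exists_isHom_fractionRing`). The coaction extends to fractions because the kernel of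
  the counit `H ⊗ L → L` is nil: by Frobenius, `h ^ p ^ m = ε(h) ^ p ^ m` for `h` in
  `H = k[v_m]`. As `k` is perfect, this also shows that `ε` is the constant coefficient, that is,
  `D_0 = id`.

If `K` is existentially closed, the generic point of `W` lives in the `𝔤`-field `Frac (A / I(W))`,
where it is `(D_i b_s)` with `b` its projection, and it lies outside `Z`; so such a `b` exists in
`K`. Conversely, given `b` in an extension, apply the axioms to the loci `V` of `b` and `W` of
`(D_i b_s)` over `K`, whose ideals are known by the Nullstellensatz, and to the subvariety `Z` of
`W` on which one of the finitely many inequations in question fails.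
-/

noncomputable section

/-! ### The monomial basis, the counit and the structure constants -/

namespace TruncPoly

variable {k : Type*} [CommRing k] {e N : ℕ}

theorem coeff_mk (i : MultiIdx e N) (f : MvPolynomial (Fin e) k) :
    coeff k i (Ideal.Quotient.mk _ f) = MvPolynomial.coeff i.toFinsupp f := rfl

theorem toFinsupp_injective : Function.Injective (MultiIdx.toFinsupp (e := e) (N := N)) := by
  intro i j h
  funext s
  have := DFunLike.congr_fun h s
  simpa [MultiIdx.toFinsupp, Fin.ext_iff] using this

theorem coeff_mon (i j : MultiIdx e N) :
    coeff k i (mon k j) = if j = i then 1 else 0 := by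
  classical
  rw [mon, coeff_mk, MvPolynomial.coeff_monomial]
  simp only [toFinsupp_injective.eq_iff]

theorem sum_coeff_smul_mon (x : TruncPoly k e N) : ∑ i, coeff k i x • mon k i = x := by
  classical
  obtain ⟨f, rfl⟩ := Ideal.Quotient.mk_surjective x
  induction f using MvPolynomial.induction_on' with
  | add f g hf hg =>
    rw [map_add]
    simp only [map_add, add_smul, Finset.sum_add_distrib, hf, hg]
  | monomial d a =>
    by_cases hd : ∀ s, d s < N
    · obtain ⟨i, rfl⟩ : ∃ i : MultiIdx e N, i.toFinsupp = d :=
        ⟨fun s => ⟨d s, hd s⟩, by ext s; simp [MultiIdx.toFinsupp]⟩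
      have h : (Ideal.Quotient.mk _ (MvPolynomial.monomial i.toFinsupp a) : TruncPoly k e N)
          = a • mon k i := by
        rw [← mul_one a, ← smul_eq_mul a 1, ← MvPolynomial.smul_monomial, smul_eq_mul, mul_one]
        rfl
      rw [h]
      simp [coeff_mon]
    · push Not at hd
      obtain ⟨s, hs⟩ := hd
      have h : (Ideal.Quotient.mk _ (MvPolynomial.monomial d a) : TruncPoly k e N) = 0 := by
        rw [Ideal.Quotient.eq_zero_iff_mem]
        have hle : Finsupp.single s N ≤ d := by simpa using hs
        have : MvPolynomial.monomial d a =
            MvPolynomial.monomial (d - Finsupp.single s N) a * MvPolynomial.X s ^ N := by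
          rw [MvPolynomial.X_pow_eq_monomial, MvPolynomial.monomial_mul, mul_one,
            tsub_add_cancel_of_le hle]
        rw [this]
        exact Ideal.mul_mem_left _ _ (Ideal.subset_span ⟨s, rfl⟩)
      rw [h]
      simp

theorem coeff_zero_algebraMap [NeZero N] (c : k) :
    coeff k (0 : MultiIdx e N) (algebraMap k (TruncPoly k e N) c) = c := by
  have : algebraMap k (TruncPoly k e N) c = Ideal.Quotient.mk _ (MvPolynomial.C c) := rfl
  rw [this, coeff_mk]
  have h0 : (0 : MultiIdx e N).toFinsupp = 0 := by ext; simp [MultiIdx.toFinsupp]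
  rw [h0, MvPolynomial.coeff_zero_C]

/-- The `p ^ m`-power Frobenius of `k[v_m]` factors through the constant coefficient, because it
kills each `X_s`. -/
theorem pow_eq_algebraMap (p m : ℕ) [Fact p.Prime] [CharP k p] (x : TruncPoly k e (p ^ m)) :
    x ^ p ^ m = algebraMap k _ (coeff k 0 x ^ p ^ m) := by
  have hinj : Function.Injective (algebraMap k (TruncPoly k e (p ^ m))) :=
    Function.LeftInverse.injective coeff_zero_algebraMap
  have : CharP (TruncPoly k e (p ^ m)) p := charP_of_injective_algebraMap hinj p
  obtain ⟨f, rfl⟩ := Ideal.Quotient.mk_surjective x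
  induction f using MvPolynomial.induction_on with
  | C a =>
    have h : (Ideal.Quotient.mk _ (MvPolynomial.C a) : TruncPoly k e (p ^ m)) =
      algebraMap k _ a := rfl
    rw [h, coeff_zero_algebraMap, map_pow]
  | add f g hf hg =>
    rw [map_add, add_pow_char_pow, hf, hg, map_add, add_pow_char_pow, map_add]
  | mul_X f s _ =>
    have hX : (Ideal.Quotient.mk _ (MvPolynomial.X s) : TruncPoly k e (p ^ m)) ^ p ^ m = 0 := by
      rw [← map_pow]
      exact Ideal.Quotient.eq_zero_iff_mem.2 (Ideal.subset_span ⟨s, rfl⟩)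
    have h0 : (0 : MultiIdx e (p ^ m)).toFinsupp = 0 := by ext; simp [MultiIdx.toFinsupp]
    rw [map_mul, mul_pow, hX, mul_zero, ← map_mul, coeff_mk, h0, MvPolynomial.coeff_mul_X']
    have : p ^ m ≠ 0 := pow_ne_zero _ (Fact.out : p.Prime).ne_zero
    simp [zero_pow this]

end TruncPoly

section Hopf

variable {k H : Type*} [CommRing k] [CommRing H] [HopfAlgebra k H] {e N : ℕ}
  (φ : H ≃ₐ[k] TruncPoly k e N)

theorem gCoeff_gMon (i j : MultiIdx e N) : gCoeff φ i (gMon φ j) = if j = i then 1 else 0 := by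
  simp [gCoeff, gMon, TruncPoly.coeff_mon]

theorem sum_gCoeff_smul_gMon (h : H) : ∑ i, gCoeff φ i h • gMon φ i = h := by
  apply φ.injective
  simp [gCoeff, gMon, map_sum, TruncPoly.sum_coeff_smul_mon]

/-- The coordinate of an element of `H ⊗ M` at the basis vector `v ^ i` of `H`. -/
def tensorCoord (M : Type*) [AddCommGroup M] [Module k M] (i : MultiIdx e N) : H ⊗[k] M →ₗ[k] M :=
  (TensorProduct.lid k M).toLinearMap ∘ₗ (gCoeff φ i).rTensor M

section
variable {M M' : Type*} [AddCommGroup M] [Module k M] [AddCommGroup M'] [Module k M']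

@[simp]
theorem tensorCoord_tmul (i : MultiIdx e N) (h : H) (x : M) :
    tensorCoord φ M i (h ⊗ₜ x) = gCoeff φ i h • x := by
  simp [tensorCoord]

theorem sum_gMon_tmul_tensorCoord (y : H ⊗[k] M) :
    ∑ i, gMon φ i ⊗ₜ[k] tensorCoord φ M i y = y := by
  induction y with
  | zero => simp
  | add x y hx hy => simp only [map_add, TensorProduct.tmul_add, Finset.sum_add_distrib, hx, hy]
  | tmul h x =>
    simp only [tensorCoord_tmul, ← TensorProduct.smul_tmul, ← TensorProduct.sum_tmul,
      sum_gCoeff_smul_gMon]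

theorem tensorCoord_sum (x : MultiIdx e N → M) (i : MultiIdx e N) :
    tensorCoord φ M i (∑ j, gMon φ j ⊗ₜ[k] x j) = x i := by
  classical
  simp [map_sum, gCoeff_gMon]

variable {φ} in
theorem tensorCoord_ext {y z : H ⊗[k] M} (h : ∀ i, tensorCoord φ M i y = tensorCoord φ M i z) :
    y = z := by
  rw [← sum_gMon_tmul_tensorCoord φ y, ← sum_gMon_tmul_tensorCoord φ z]
  simp only [h]

theorem tensorCoord_lTensor (f : M →ₗ[k] M') (i : MultiIdx e N) (y : H ⊗[k] M) :
    tensorCoord φ M' i (f.lTensor H y) = f (tensorCoord φ M i y) := by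
  induction y with
  | zero => simp
  | add x y hx hy => simp only [map_add, hx, hy]
  | tmul h x => simp

/-- The comultiplication of `v ^ l` in terms of the structure constants, tensored with an arbitrary
vector. -/
theorem assoc_comul_gMon_tmul (l : MultiIdx e N) (x : M) :
    TensorProduct.assoc k H H M (Coalgebra.comul (R := k) (gMon φ l) ⊗ₜ x) =
      ∑ i, gMon φ i ⊗ₜ[k] ∑ j, gMon φ j ⊗ₜ[k] (structConst φ i j l • x) := by
  refine tensorCoord_ext (φ := φ) fun i => ?_
  rw [tensorCoord_sum]
  refine tensorCoord_ext (φ := φ) fun j => ?_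
  rw [tensorCoord_sum, structConst]
  generalize Coalgebra.comul (R := k) (gMon φ l) = w
  induction w with
  | zero => simp
  | add x y hx hy => simp only [TensorProduct.add_tmul, map_add, hx, hy, add_smul]
  | tmul a b => simp [mul_smul]

/-- The map `Δ ⊗ 1` in coordinates. -/
theorem assoc_rTensor_comul_sum (x : MultiIdx e N → M) :
    TensorProduct.assoc k H H M
      ((Coalgebra.comul (R := k) (A := H)).rTensor M (∑ l, gMon φ l ⊗ₜ[k] x l)) =
      ∑ i, gMon φ i ⊗ₜ[k] ∑ j, gMon φ j ⊗ₜ[k] ∑ l, structConst φ i j l • x l := by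
  simp only [map_sum, LinearMap.rTensor_tmul, assoc_comul_gMon_tmul φ, TensorProduct.tmul_sum]
  rw [Finset.sum_comm]
  exact Finset.sum_congr rfl fun i _ => Finset.sum_comm

end

end Hopf

section Counit

variable {p m : ℕ} [Fact p.Prime] {k : Type*} [CommRing k] [CharP k p]
  {H : Type*} [CommRing H] [HopfAlgebra k H] {e : ℕ} (φ : H ≃ₐ[k] TruncPoly k e (p ^ m))

theorem pow_eq_algebraMap_gCoeff (h : H) :
    h ^ p ^ m = algebraMap k H (gCoeff φ 0 h ^ p ^ m) := by
  apply φ.injective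
  rw [map_pow, TruncPoly.pow_eq_algebraMap]
  simp [gCoeff]

theorem counit_pow_eq (h : H) :
    Coalgebra.counit (R := k) h ^ p ^ m = gCoeff φ 0 h ^ p ^ m := by
  have := congrArg (Bialgebra.counitAlgHom k H) (pow_eq_algebraMap_gCoeff φ h)
  rw [map_pow, AlgHom.commutes] at this
  exact this

/-- The augmentation ideal of `H` is nil: `h` and its counit have the same `p ^ m`-th power. -/
theorem isNilpotent_sub_counit (φ : H ≃ₐ[k] TruncPoly k e (p ^ m)) (h : H) :
    IsNilpotent (h - algebraMap k H (Coalgebra.counit (R := k) h)) := by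
  have hinj : Function.Injective (algebraMap k H) := fun a b hab => by
    simpa using congrArg (Coalgebra.counit (R := k)) hab
  have : CharP H p := charP_of_injective_algebraMap hinj p
  refine ⟨p ^ m, ?_⟩
  rw [sub_pow_char_pow, pow_eq_algebraMap_gCoeff φ h, ← map_pow (algebraMap k H), counit_pow_eq φ,
    sub_self]

/-- The counit is the constant coefficient. Both have the same `p ^ m`-th power, and `k`, being
perfect, is reduced. -/
theorem counit_eq_gCoeff_zero [PerfectRing k p] (h : H) :
    Coalgebra.counit (R := k) h = gCoeff φ 0 h :=
  (bijective_iterateFrobenius k p m).1 (counit_pow_eq φ h)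

/-- An element of `H ⊗ R` is invertible if its image in `R` under the counit is, because the kernel
of `H ⊗ R → R` is nil. -/
theorem isUnit_of_isUnit_counit (φ : H ≃ₐ[k] TruncPoly k e (p ^ m)) {R : Type*} [CommRing R]
    [Algebra k R] {y : H ⊗[k] R}
    (hy : IsUnit (TensorProduct.lid k R ((Coalgebra.counit (R := k) (A := H)).rTensor R y))) :
    IsUnit y := by
  have hnil (y : H ⊗[k] R) : IsNilpotent (y - Algebra.TensorProduct.includeRight
      (TensorProduct.lid k R ((Coalgebra.counit (R := k) (A := H)).rTensor R y))) := by
    induction y with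
    | zero => simp
    | add x y hx hy =>
      simpa only [map_add, add_sub_add_comm] using (Commute.all _ _).isNilpotent_add hx hy
    | tmul h r =>
      have : h ⊗ₜ[k] r - Algebra.TensorProduct.includeRight (A := H)
          (TensorProduct.lid k R ((Coalgebra.counit (R := k) (A := H)).rTensor R (h ⊗ₜ r))) =
          (h - algebraMap k H (Coalgebra.counit (R := k) h)) ⊗ₜ[k] (1 : R) * 1 ⊗ₜ r := by
        simp [TensorProduct.sub_tmul, Algebra.algebraMap_eq_smul_one, TensorProduct.smul_tmul,
          sub_mul]
      rw [this]
      refine (Commute.all _ _).isNilpotent_mul_right ?_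
      exact (isNilpotent_sub_counit φ h).map (Algebra.TensorProduct.includeLeft (S := k) (B := R))
  have := (hnil y).isUnit_add_right_of_commute (hy.map Algebra.TensorProduct.includeRight)
    (Commute.all _ _)
  simpa using this

end Counit

section StructConst

variable {p m : ℕ} [Fact p.Prime] {k : Type*} [CommRing k] [CharP k p] [PerfectRing k p]
  {H : Type*} [CommRing H] [HopfAlgebra k H] {e : ℕ} (φ : H ≃ₐ[k] TruncPoly k e (p ^ m))

/-- One half of the counit axiom: `c_{i,0}^l` is the Kronecker delta. -/
theorem structConst_zero_right (i l : MultiIdx e (p ^ m)) :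
    structConst φ i 0 l = if l = i then 1 else 0 := by
  have h0 : gCoeff φ 0 = Coalgebra.counit (R := k) (A := H) :=
    LinearMap.ext fun h => (counit_eq_gCoeff_zero φ h).symm
  rw [structConst, h0, ← gCoeff_gMon φ i l]
  have := congrArg (fun y => TensorProduct.lid k k ((gCoeff φ i).rTensor k y))
    (Coalgebra.lTensor_counit_comul (R := k) (gMon φ l))
  rw [← LinearMap.comp_apply, LinearMap.rTensor_comp_lTensor] at this
  simpa using this

/-- The other half of the counit axiom: `c_{0,j}^l` is the Kronecker delta. -/
theorem structConst_zero_left (j l : MultiIdx e (p ^ m)) :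
    structConst φ 0 j l = if l = j then 1 else 0 := by
  have h0 : gCoeff φ 0 = Coalgebra.counit (R := k) (A := H) :=
    LinearMap.ext fun h => (counit_eq_gCoeff_zero φ h).symm
  rw [structConst, h0, ← gCoeff_gMon φ j l]
  have := congrArg (fun y => TensorProduct.lid k k ((gCoeff φ j).lTensor k y))
    (Coalgebra.rTensor_counit_comul (R := k) (gMon φ l))
  rw [← LinearMap.comp_apply, LinearMap.lTensor_comp_rTensor] at this
  simpa using this

end StructConst

/-! ### Morphisms of `𝔤`-rings -/

namespace GDerivation

section Basic

variable {k H R R' : Type*} [CommRing k] [CommRing H] [HopfAlgebra k H] [CommRing R] [Algebra k R]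
  [CommRing R'] [Algebra k R']

/-- A morphism of `𝔤`-rings: a `k`-algebra homomorphism commuting with the coactions. -/
def IsHom (D : GDerivation k H R) (D' : GDerivation k H R') (f : R →ₐ[k] R') : Prop :=
  ∀ r, D'.toAlgHom (f r) = Algebra.TensorProduct.map (AlgHom.id k H) f (D.toAlgHom r)

theorem tensorMap_comp {R'' : Type*} [CommRing R''] [Algebra k R''] (f : R →ₐ[k] R')
    (g : R' →ₐ[k] R'') (y : H ⊗[k] R) :
    Algebra.TensorProduct.map (AlgHom.id k H) (g.comp f) y =
      Algebra.TensorProduct.map (AlgHom.id k H) g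
        (Algebra.TensorProduct.map (AlgHom.id k H) f y) := by
  rw [← AlgHom.comp_apply (Algebra.TensorProduct.map _ _), ← Algebra.TensorProduct.map_comp,
    AlgHom.comp_id]

theorem IsHom.comp {R'' : Type*} [CommRing R''] [Algebra k R''] {D : GDerivation k H R}
    {D' : GDerivation k H R'} {D'' : GDerivation k H R''} {f : R →ₐ[k] R'} {g : R' →ₐ[k] R''}
    (hg : IsHom D' D'' g) (hf : IsHom D D' f) : IsHom D D'' (g.comp f) := fun r => by
  rw [AlgHom.comp_apply, hg, hf, ← tensorMap_comp]

section
variable {e N : ℕ} (φ : H ≃ₐ[k] TruncPoly k e N) (D : GDerivation k H R)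

theorem op_eq_tensorCoord (i : MultiIdx e N) (r : R) :
    D.op φ i r = tensorCoord φ R i (D.toAlgHom r) := rfl

theorem sum_gMon_tmul_op (r : R) : ∑ i, gMon φ i ⊗ₜ[k] D.op φ i r = D.toAlgHom r :=
  sum_gMon_tmul_tensorCoord φ _

/-- Coassociativity in coordinates: `D_j ∘ D_i = ∑ l, c_{i,j}^l D_l`. -/
theorem op_op (i j : MultiIdx e N) (r : R) :
    D.op φ j (D.op φ i r) = ∑ l, structConst φ i j l • D.op φ l r := by
  have h := D.coassoc r
  rw [← D.sum_gMon_tmul_op φ r, assoc_rTensor_comul_sum] at h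
  have h1 := congrArg (tensorCoord φ (H ⊗[k] R) i) h
  rw [tensorCoord_sum, tensorCoord_lTensor, tensorCoord_sum] at h1
  rw [op_eq_tensorCoord, ← AlgHom.toLinearMap_apply, ← h1, tensorCoord_sum]

theorem tensorCoord_map (f : R →ₐ[k] R') (i : MultiIdx e N) (y : H ⊗[k] R) :
    tensorCoord φ R' i (Algebra.TensorProduct.map (AlgHom.id k H) f y) =
      f (tensorCoord φ R i y) :=
  tensorCoord_lTensor φ f.toLinearMap i y

theorem map_eq_zero_iff_tensorCoord (f : R →ₐ[k] R') (y : H ⊗[k] R) :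
    Algebra.TensorProduct.map (AlgHom.id k H) f y = 0 ↔ ∀ i, f (tensorCoord φ R i y) = 0 := by
  refine ⟨fun h i => by rw [← tensorCoord_map, h, map_zero], fun h => ?_⟩
  exact tensorCoord_ext (φ := φ) fun i => by rw [tensorCoord_map, h, map_zero]

theorem IsHom.map_op {D : GDerivation k H R} {D' : GDerivation k H R'} {f : R →ₐ[k] R'}
    (h : IsHom D D' f) (i : MultiIdx e N) (r : R) : D'.op φ i (f r) = f (D.op φ i r) := by
  rw [op_eq_tensorCoord, h, tensorCoord_map, op_eq_tensorCoord]

theorem map_sum_gMon_tmul (f : R →ₐ[k] R') (x : MultiIdx e N → R) :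
    Algebra.TensorProduct.map (AlgHom.id k H) f (∑ i, gMon φ i ⊗ₜ[k] x i) =
      ∑ i, gMon φ i ⊗ₜ[k] f (x i) := by
  simp

end

section Transport

variable (D : GDerivation k H R) {f : R →ₐ[k] R'} {δ : R' →ₐ[k] H ⊗[k] R'}

theorem counit_map (f : R →ₐ[k] R') (y : H ⊗[k] R) :
    TensorProduct.lid k R' ((Coalgebra.counit (R := k) (A := H)).rTensor R'
      (Algebra.TensorProduct.map (AlgHom.id k H) f y)) =
    f (TensorProduct.lid k R ((Coalgebra.counit (R := k) (A := H)).rTensor R y)) := by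
  induction y with
  | zero => simp
  | add x y hx hy => simp only [map_add, hx, hy]
  | tmul a b => simp

/-- A coaction compatible with a `𝔤`-derivation along `f` is counital on the image of `f`. -/
theorem counit_of_compat
    (h : ∀ r, δ (f r) = Algebra.TensorProduct.map (AlgHom.id k H) f (D.toAlgHom r)) (r : R) :
    TensorProduct.lid k R' ((Coalgebra.counit (R := k) (A := H)).rTensor R' (δ (f r))) = f r := by
  rw [h, counit_map, D.counit_coaction]

/-- A coaction compatible with a `𝔤`-derivation along `f` is coassociative on the image of `f`. -/
theorem coassoc_of_compat
    (h : ∀ r, δ (f r) = Algebra.TensorProduct.map (AlgHom.id k H) f (D.toAlgHom r)) (r : R) :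
    TensorProduct.assoc k H H R' ((Coalgebra.comul (R := k) (A := H)).rTensor R' (δ (f r))) =
      δ.toLinearMap.lTensor H (δ (f r)) := by
  have key (y : H ⊗[k] R) :
      TensorProduct.assoc k H H R' ((Coalgebra.comul (R := k) (A := H)).rTensor R'
        (Algebra.TensorProduct.map (AlgHom.id k H) f y)) =
      Algebra.TensorProduct.map (AlgHom.id k H) (Algebra.TensorProduct.map (AlgHom.id k H) f)
        (TensorProduct.assoc k H H R ((Coalgebra.comul (R := k) (A := H)).rTensor R y)) := by
    induction y with
    | zero => simp
    | add x y hx hy => simp only [map_add, hx, hy]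
    | tmul a b =>
      simp only [Algebra.TensorProduct.map_tmul, LinearMap.rTensor_tmul, AlgHom.coe_id, id_eq]
      generalize Coalgebra.comul (R := k) a = w
      induction w with
      | zero => simp
      | add x y hx hy => simp only [TensorProduct.add_tmul, map_add, hx, hy]
      | tmul a b => simp
  have key' (y : H ⊗[k] R) :
      δ.toLinearMap.lTensor H (Algebra.TensorProduct.map (AlgHom.id k H) f y) =
      Algebra.TensorProduct.map (AlgHom.id k H) (Algebra.TensorProduct.map (AlgHom.id k H) f)
        (D.toAlgHom.toLinearMap.lTensor H y) := by
    induction y with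
    | zero => simp
    | add x y hx hy => simp only [map_add, hx, hy]
    | tmul a b => simp [h]
  rw [h, key, D.coassoc, key']

end Transport

/-- A `k`-algebra homomorphism `R → H ⊗ R` is a `𝔤`-derivation as soon as the two axioms hold on a
set of elements which determines ring homomorphisms out of `R`. -/
def ofEqOn (δ : R →ₐ[k] H ⊗[k] R) (S : Set R)
    (hS : ∀ f g : R →+* H ⊗[k] (H ⊗[k] R), Set.EqOn f g S → f = g)
    (hS' : ∀ f g : R →+* R, Set.EqOn f g S → f = g)
    (h₁ : ∀ r ∈ S,
      TensorProduct.lid k R ((Coalgebra.counit (R := k) (A := H)).rTensor R (δ r)) = r)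
    (h₂ : ∀ r ∈ S,
      TensorProduct.assoc k H H R ((Coalgebra.comul (R := k) (A := H)).rTensor R (δ r)) =
        δ.toLinearMap.lTensor H (δ r)) : GDerivation k H R where
  toAlgHom := δ
  counit_coaction := by
    let F : R →ₐ[k] R := (Algebra.TensorProduct.lid k R).toAlgHom.comp
      ((Algebra.TensorProduct.map (Bialgebra.counitAlgHom k H) (AlgHom.id k R)).comp δ)
    exact RingHom.congr_fun (hS' F.toRingHom (RingHom.id R) h₁)
  coassoc := by
    let F : R →ₐ[k] H ⊗[k] (H ⊗[k] R) := (Algebra.TensorProduct.assoc k k k H H R).toAlgHom.comp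
      ((Algebra.TensorProduct.map (Bialgebra.comulAlgHom k H) (AlgHom.id k R)).comp δ)
    let G : R →ₐ[k] H ⊗[k] (H ⊗[k] R) :=
      (Algebra.TensorProduct.map (AlgHom.id k H) δ).comp δ
    exact RingHom.congr_fun (hS F.toRingHom G.toRingHom h₂)

end Basic

end GDerivation

section Regular

variable {k H : Type*} [CommRing k] [CommRing H] [HopfAlgebra k H] {e N : ℕ}
  (φ : H ≃ₐ[k] TruncPoly k e N)

variable (k H) in
/-- The action of `𝔤` on itself by translation. -/
def GDerivation.regular : GDerivation k H H where
  toAlgHom := Bialgebra.comulAlgHom k H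
  counit_coaction r := by
    have : Bialgebra.comulAlgHom k H r = Coalgebra.comul r := rfl
    rw [this, Coalgebra.rTensor_counit_comul]
    simp
  coassoc r := Coalgebra.coassoc_apply r

/-- Coassociativity of the comultiplication in terms of the structure constants: the formula for
`D_a ∘ D_i` in the case of the translation action, applied to `v ^ l`. -/
theorem sum_structConst_mul (i a b l : MultiIdx e N) :
    ∑ j, structConst φ a b j * structConst φ i j l =
      ∑ r, structConst φ i a r * structConst φ r b l := by
  have hop (i l : MultiIdx e N) : (GDerivation.regular k H).op φ i (gMon φ l) =
      ∑ j, structConst φ i j l • gMon φ j := by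
    rw [← sum_gCoeff_smul_gMon φ (GDerivation.op _ _ _ _)]
    refine Finset.sum_congr rfl fun j _ => ?_
    congr 1
    rw [structConst, GDerivation.op_eq_tensorCoord]
    change gCoeff φ j (tensorCoord φ H i (Coalgebra.comul (R := k) (gMon φ l))) = _
    generalize Coalgebra.comul (R := k) (gMon φ l) = w
    induction w with
    | zero => simp
    | add x y hx hy => simp only [map_add, hx, hy]
    | tmul a b => simp
  have h := congrArg (gCoeff φ b) ((GDerivation.regular k H).op_op φ i a (gMon φ l))
  have hlin (c : MultiIdx e N → k) : (GDerivation.regular k H).op φ a (∑ j, c j • gMon φ j) =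
      ∑ j, c j • (GDerivation.regular k H).op φ a (gMon φ j) := by
    simp only [GDerivation.op_eq_tensorCoord, map_sum, map_smul]
  rw [hop, hlin] at h
  simpa [hop, gCoeff_gMon, mul_comm] using h

end Regular

/-! ### Free `𝔤`-rings and fields of fractions -/

namespace GDerivation

section FreeCoaction

variable {k : Type*} [CommRing k] {H : Type*} [CommRing H] [HopfAlgebra k H] {e N : ℕ}
  (φ : H ≃ₐ[k] TruncPoly k e N) {R : Type*} [CommRing R]

section
variable [Algebra k R] (D : GDerivation k H R)

/-- The coaction on `R[x_{s,i}]` which extends the one on `R` and satisfies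
`x_{s,i} ↦ ∑ j, v ^ j ⊗ ∑ l, c_{i,j}^l x_{s,l}`. -/
def freeCoaction (σ : Type*) : MvPolynomial (σ × MultiIdx e N) R →ₐ[k]
    H ⊗[k] MvPolynomial (σ × MultiIdx e N) R where
  __ := MvPolynomial.eval₂Hom
    ((Algebra.TensorProduct.map (AlgHom.id k H)
      (IsScalarTower.toAlgHom k R (MvPolynomial (σ × MultiIdx e N) R))).comp
        D.toAlgHom).toRingHom
    fun q => ∑ j, gMon φ j ⊗ₜ ∑ l, structConst φ q.2 j l • MvPolynomial.X (q.1, l)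
  commutes' c := by
    rw [IsScalarTower.algebraMap_apply k R (MvPolynomial _ R)]
    simp [MvPolynomial.algebraMap_eq]

theorem freeCoaction_C (σ : Type*) (r : R) :
    D.freeCoaction φ σ (IsScalarTower.toAlgHom k R (MvPolynomial _ R) r) =
      Algebra.TensorProduct.map (AlgHom.id k H)
        (IsScalarTower.toAlgHom k R (MvPolynomial _ R)) (D.toAlgHom r) :=
  MvPolynomial.eval₂Hom_C _ _ _

theorem freeCoaction_X {σ : Type*} (q : σ × MultiIdx e N) :
    D.freeCoaction φ σ (MvPolynomial.X q) =
      ∑ j, gMon φ j ⊗ₜ ∑ l, structConst φ q.2 j l • MvPolynomial.X (q.1, l) :=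
  MvPolynomial.eval₂Hom_X' _ _ _

theorem tensorCoord_freeCoaction_X {σ : Type*} (q : σ × MultiIdx e N) (j : MultiIdx e N) :
    tensorCoord φ _ j (D.freeCoaction φ σ (MvPolynomial.X q)) =
      ∑ l, structConst φ q.2 j l • MvPolynomial.X (q.1, l) := by
  rw [freeCoaction_X, tensorCoord_sum]

end

variable {L : Type*} [CommRing L] [Algebra k L] [Algebra R L] {σ : Type*}

/-- The homomorphism from the free `𝔤`-ring `R[x_{s,i}]` sending `x_{s,i}` to `D_i b_s`. -/
def evalFree (D' : GDerivation k H L) (b : σ → L) :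
    MvPolynomial (σ × MultiIdx e N) R →ₐ[R] L :=
  MvPolynomial.aeval fun q => D'.op φ q.2 (b q.1)

theorem evalFree_X (D' : GDerivation k H L) (b : σ → L) (q : σ × MultiIdx e N) :
    evalFree (R := R) φ D' b (MvPolynomial.X q) = D'.op φ q.2 (b q.1) :=
  MvPolynomial.aeval_X _ _

end FreeCoaction

section Free

variable {p m : ℕ} [Fact p.Prime] {k : Type*} [CommRing k] [CharP k p] [PerfectRing k p]
  {H : Type*} [CommRing H] [HopfAlgebra k H] {e : ℕ} (φ : H ≃ₐ[k] TruncPoly k e (p ^ m))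
  {R : Type*} [CommRing R] [Algebra k R] (D : GDerivation k H R)

theorem counit_eq_tensorCoord_zero {M : Type*} [AddCommGroup M] [Module k M] (y : H ⊗[k] M) :
    TensorProduct.lid k M ((Coalgebra.counit (R := k) (A := H)).rTensor M y) =
      tensorCoord φ M 0 y := by
  have h0 : gCoeff φ 0 = Coalgebra.counit (R := k) (A := H) :=
    LinearMap.ext fun h => (counit_eq_gCoeff_zero φ h).symm
  rw [tensorCoord, h0]
  rfl

@[simp]
theorem op_zero (r : R) : D.op φ 0 r = r := by
  rw [op_eq_tensorCoord, ← counit_eq_tensorCoord_zero, D.counit_coaction]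

/-- The free `𝔤`-ring over the `𝔤`-ring `R` on generators `x_{s,0}`, `s ∈ σ`: the polynomial ring
in the indeterminates `x_{s,i} = D_i x_{s,0}`. Its spectrum is the prolongation `∇ 𝔸^σ`. -/
def free (σ : Type*) : GDerivation k H (MvPolynomial (σ × MultiIdx e (p ^ m)) R) :=
  ofEqOn (D.freeCoaction φ σ) (Set.range (IsScalarTower.toAlgHom k R _) ∪ Set.range MvPolynomial.X)
    (fun f g h => MvPolynomial.ringHom_ext (fun r => h (.inl ⟨r, rfl⟩))
      fun q => h (.inr ⟨q, rfl⟩))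
    (fun f g h => MvPolynomial.ringHom_ext (fun r => h (.inl ⟨r, rfl⟩))
      fun q => h (.inr ⟨q, rfl⟩))
    (by
      rintro _ (⟨r, rfl⟩ | ⟨q, rfl⟩)
      · exact D.counit_of_compat (D.freeCoaction_C φ σ) r
      · rw [counit_eq_tensorCoord_zero φ, freeCoaction_X, tensorCoord_sum]
        simp [structConst_zero_right])
    (by
      rintro _ (⟨r, rfl⟩ | ⟨q, rfl⟩)
      · exact D.coassoc_of_compat (D.freeCoaction_C φ σ) r
      · rw [freeCoaction_X, assoc_rTensor_comul_sum]
        refine tensorCoord_ext (φ := φ) fun a => ?_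
        rw [tensorCoord_sum, tensorCoord_lTensor, tensorCoord_sum]
        refine tensorCoord_ext (φ := φ) fun b => ?_
        rw [tensorCoord_sum]
        simp only [AlgHom.toLinearMap_apply, map_sum, map_smul, tensorCoord_freeCoaction_X,
          Finset.smul_sum, smul_smul]
        rw [Finset.sum_comm]
        conv_rhs => rw [Finset.sum_comm]
        refine Finset.sum_congr rfl fun l _ => ?_
        rw [← Finset.sum_smul, ← Finset.sum_smul, sum_structConst_mul])

theorem toAlgHom_free (σ : Type*) : (D.free φ σ).toAlgHom = D.freeCoaction φ σ := rfl

theorem isHom_C (σ : Type*) : IsHom D (D.free φ σ) (IsScalarTower.toAlgHom k R _) :=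
  D.freeCoaction_C φ σ

theorem free_op_X {σ : Type*} (s : σ) (i j : MultiIdx e (p ^ m)) :
    (D.free φ σ).op φ j (MvPolynomial.X (s, i)) =
      ∑ l, structConst φ i j l • MvPolynomial.X (s, l) := by
  rw [op_eq_tensorCoord, toAlgHom_free, tensorCoord_freeCoaction_X]

theorem free_op_X_zero {σ : Type*} (s : σ) (j : MultiIdx e (p ^ m)) :
    (D.free φ σ).op φ j (MvPolynomial.X (s, 0)) = MvPolynomial.X (s, j) := by
  rw [free_op_X]
  simp [structConst_zero_left]

section Eval

variable {L : Type*} [CommRing L] [Algebra k L] [Algebra R L] [IsScalarTower k R L] {σ : Type*}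

theorem isHom_evalFree {D : GDerivation k H R} {D' : GDerivation k H L}
    (h : IsHom D D' (IsScalarTower.toAlgHom k R L)) (b : σ → L) :
    IsHom (D.free φ σ) D' ((evalFree (R := R) φ D' b).restrictScalars k) := by
  let F := D'.toAlgHom.comp ((evalFree (R := R) φ D' b).restrictScalars k)
  let G := (Algebra.TensorProduct.map (AlgHom.id k H)
    ((evalFree (R := R) φ D' b).restrictScalars k)).comp (D.free φ σ).toAlgHom
  suffices F.toRingHom = G.toRingHom from fun r => RingHom.congr_fun this r
  have hC : (((evalFree (R := R) φ D' b).restrictScalars k).comp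
      (IsScalarTower.toAlgHom k R (MvPolynomial (σ × MultiIdx e (p ^ m)) R))) =
      IsScalarTower.toAlgHom k R L := by
    ext r
    simp [evalFree]
  refine MvPolynomial.ringHom_ext (fun r => ?_) fun q => ?_
  · have h1 : G.toRingHom (MvPolynomial.C r) = _ :=
      congrArg (Algebra.TensorProduct.map (AlgHom.id k H)
        ((evalFree (R := R) φ D' b).restrictScalars k)) (D.isHom_C φ σ r)
    rw [h1, ← tensorMap_comp, hC, ← h r, ← hC]
    rfl
  · change D'.toAlgHom (evalFree (R := R) φ D' b (MvPolynomial.X q)) =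
      Algebra.TensorProduct.map (AlgHom.id k H) _ (D.freeCoaction φ σ (MvPolynomial.X q))
    rw [evalFree_X, freeCoaction_X, map_sum_gMon_tmul, ← sum_gMon_tmul_op φ]
    simp [op_op, evalFree_X]

end Eval

end Free

section FractionField

variable {p m : ℕ} [Fact p.Prime] {k : Type*} [CommRing k] [CharP k p]
  {H : Type*} [CommRing H] [HopfAlgebra k H] {e : ℕ} (φ : H ≃ₐ[k] TruncPoly k e (p ^ m))
  {A : Type*} [CommRing A] [Algebra k A] (D : GDerivation k H A)

/-- A prime ideal stable under the operators `D_i` is the kernel of a morphism to a `𝔤`-field, with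
underlying field the field of fractions of the quotient. The coaction extends to fractions since an
element of `H ⊗ L` is invertible as soon as its counit is. -/
theorem exists_isHom_fractionRing (P : Ideal A) [P.IsPrime]
    (hP : ∀ f ∈ P, ∀ i, D.op φ i f ∈ P) :
    ∃ D' : GDerivation k H (FractionRing (A ⧸ P)),
      IsHom D D' ((IsScalarTower.toAlgHom k (A ⧸ P) (FractionRing (A ⧸ P))).comp
        (Ideal.Quotient.mkₐ k P)) := by
  let L := FractionRing (A ⧸ P)
  let q : A →ₐ[k] L := (IsScalarTower.toAlgHom k (A ⧸ P) L).comp (Ideal.Quotient.mkₐ k P)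
  have hq (f : A) : q f = 0 ↔ f ∈ P := by
    have : q f = algebraMap (A ⧸ P) L (Ideal.Quotient.mk P f) := rfl
    rw [this, FaithfulSMul.algebraMap_eq_zero_iff, Ideal.Quotient.eq_zero_iff_mem]
  let θ : A →ₐ[k] H ⊗[k] L := (Algebra.TensorProduct.map (AlgHom.id k H) q).comp D.toAlgHom
  have hθ : ∀ f ∈ P, θ f = 0 := fun f hf =>
    (map_eq_zero_iff_tensorCoord φ q (D.toAlgHom f)).2 fun i => (hq _).2 (hP f hf i)
  have hunit (y : nonZeroDivisors (A ⧸ P)) : IsUnit (Ideal.Quotient.liftₐ P θ hθ y) := by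
    obtain ⟨f, hf⟩ := Ideal.Quotient.mk_surjective (y : A ⧸ P)
    rw [← hf]
    refine isUnit_of_isUnit_counit φ ?_
    have hfθ : Ideal.Quotient.liftₐ P θ hθ (Ideal.Quotient.mk P f) = θ f := rfl
    have hθf : θ f = Algebra.TensorProduct.map (AlgHom.id k H) q (D.toAlgHom f) := rfl
    rw [hfθ, hθf, counit_map, D.counit_coaction, isUnit_iff_ne_zero, Ne, hq,
      ← Ideal.Quotient.eq_zero_iff_mem, hf]
    exact nonZeroDivisors.coe_ne_zero y
  let δ : L →ₐ[k] H ⊗[k] L := IsLocalization.liftAlgHom hunit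
  have hδ (f : A) : δ (q f) = Algebra.TensorProduct.map (AlgHom.id k H) q (D.toAlgHom f) :=
    IsLocalization.lift_eq hunit _
  refine ⟨ofEqOn δ (Set.range q) (fun f g h => ?_) (fun f g h => ?_) ?_ ?_, hδ⟩
  · refine IsLocalization.ringHom_ext (nonZeroDivisors (A ⧸ P)) (Ideal.Quotient.ringHom_ext ?_)
    exact RingHom.ext fun x => h ⟨x, rfl⟩
  · refine IsLocalization.ringHom_ext (nonZeroDivisors (A ⧸ P)) (Ideal.Quotient.ringHom_ext ?_)
    exact RingHom.ext fun x => h ⟨x, rfl⟩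
  · rintro _ ⟨f, rfl⟩
    exact D.counit_of_compat hδ f
  · rintro _ ⟨f, rfl⟩
    exact D.coassoc_of_compat hδ f

end FractionField

end GDerivation

/-! ### Varieties and prolongations -/

section Varieties

variable {K Ω σ : Type*} [Field K] [Field Ω] [Algebra K Ω]

theorem IsKClosed.zeroLocus_vanishingIdeal {V : Set (σ → Ω)} (hV : IsKClosed K V) :
    MvPolynomial.zeroLocus Ω (MvPolynomial.vanishingIdeal K V) = V := by
  obtain ⟨I, rfl⟩ := hV
  exact MvPolynomial.zeroLocus_vanishingIdeal_galoisConnection.l_u_l_eq_l I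

theorem IsKIrreducible.isPrime_vanishingIdeal {V : Set (σ → Ω)} (hV : IsKIrreducible K V) :
    (MvPolynomial.vanishingIdeal K V).IsPrime := by
  obtain ⟨-, ⟨x, hx⟩, hirr⟩ := hV
  refine ⟨fun h => ?_, fun {f g} hfg => ?_⟩
  · have := (Ideal.eq_top_iff_one _).1 h x hx
    simp at this
  · have hcl (f : MvPolynomial σ K) : IsKClosed K {x : σ → Ω | MvPolynomial.aeval x f = 0} :=
      ⟨Ideal.span {f}, by rw [MvPolynomial.zeroLocus_span]; simp⟩
    exact hirr _ _ (hcl f) (hcl g) fun x hx =>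
      mul_eq_zero.1 ((map_mul (MvPolynomial.aeval x) f g).symm.trans (hfg x hx))

theorem isKIrreducible_zeroLocus [IsAlgClosed Ω] [Finite σ] (P : Ideal (MvPolynomial σ K))
    [hP : P.IsPrime] : IsKIrreducible K (MvPolynomial.zeroLocus Ω P) := by
  refine ⟨⟨P, rfl⟩, ?_, ?_⟩
  · rw [Set.nonempty_iff_ne_empty]
    intro h
    apply hP.ne_top
    rw [← MvPolynomial.IsPrime.vanishingIdeal_zeroLocus (K := Ω) P, h,
      MvPolynomial.vanishingIdeal_empty]
  · rintro _ _ ⟨I, rfl⟩ ⟨J, rfl⟩ h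
    have hIJ : I ⊓ J ≤ P := by
      rw [← MvPolynomial.IsPrime.vanishingIdeal_zeroLocus (K := Ω) P]
      intro f hf x hx
      exact (h hx).elim (fun h => h f hf.1) fun h => h f hf.2
    exact (hP.inf_le.1 hIJ).imp MvPolynomial.zeroLocus_anti_mono MvPolynomial.zeroLocus_anti_mono

end Varieties

namespace GDerivation

section Prolongation

variable {k : Type*} [CommRing k] {H : Type*} [CommRing H] [HopfAlgebra k H] {e N : ℕ}
  (φ : H ≃ₐ[k] TruncPoly k e N) {K : Type*} [Field K] [Algebra k K] (D : GDerivation k H K)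
  {Ω : Type*} [Field Ω] [Algebra k Ω] [Algebra K Ω] [IsScalarTower k K Ω] {σ : Type*}

theorem map_aeval_freeCoaction_C (x : σ × MultiIdx e N → Ω) (r : K) :
    Algebra.TensorProduct.map (AlgHom.id k H) ((MvPolynomial.aeval (R := K) x).restrictScalars k)
      (D.freeCoaction φ σ (MvPolynomial.C r)) = D.toD Ω r := by
  have hC : ((MvPolynomial.aeval (R := K) x).restrictScalars k).comp
      (IsScalarTower.toAlgHom k K (MvPolynomial (σ × MultiIdx e N) K)) =
      IsScalarTower.toAlgHom k K Ω := by
    ext r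
    simp
  have h := congrArg (Algebra.TensorProduct.map (AlgHom.id k H)
    ((MvPolynomial.aeval (R := K) x).restrictScalars k)) (D.freeCoaction_C φ σ r)
  rw [← tensorMap_comp, hC] at h
  exact h

end Prolongation

section Prolongation

variable {p m : ℕ} [Fact p.Prime] {k : Type*} [CommRing k] [CharP k p] [PerfectRing k p]
  {H : Type*} [CommRing H] [HopfAlgebra k H] {e : ℕ} (φ : H ≃ₐ[k] TruncPoly k e (p ^ m))
  {K : Type*} [Field K] [Algebra k K] (D : GDerivation k H K)
  {Ω : Type*} [Field Ω] [Algebra k Ω] [Algebra K Ω] [IsScalarTower k K Ω] {σ : Type*}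

/-- A polynomial evaluated at the `𝒟(Ω)`-valued point of `c(x)` is the coaction of the free
`𝔤`-ring, evaluated at `x`. -/
theorem eval₂_dPoint_cMap (x : σ × MultiIdx e (p ^ m) → Ω)
    (f : MvPolynomial (σ × MultiIdx e (p ^ m)) K) :
    MvPolynomial.eval₂ (D.toD Ω) (dPoint φ (cMap φ x)) f =
      Algebra.TensorProduct.map (AlgHom.id k H)
        ((MvPolynomial.aeval (R := K) x).restrictScalars k) ((D.free φ σ).toAlgHom f) := by
  induction f using MvPolynomial.induction_on with
  | C r => rw [MvPolynomial.eval₂_C]; exact (D.map_aeval_freeCoaction_C φ x r).symm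
  | add f g hf hg => rw [MvPolynomial.eval₂_add, hf, hg, map_add, map_add]
  | mul_X f q hf =>
    rw [MvPolynomial.eval₂_mul, hf, map_mul, map_mul, MvPolynomial.eval₂_X, toAlgHom_free,
      freeCoaction_X, map_sum_gMon_tmul]
    simp [dPoint, cMap]

/-- A polynomial evaluated at the `𝒟(Ω)`-valued point of `x` is the coaction of the free `𝔤`-ring
applied to it as a polynomial in the variables `x_{s,0}`, evaluated at `x`. -/
theorem eval₂_dPoint (x : σ × MultiIdx e (p ^ m) → Ω) (f : MvPolynomial σ K) :
    MvPolynomial.eval₂ (D.toD Ω) (dPoint φ x) f =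
      Algebra.TensorProduct.map (AlgHom.id k H)
        ((MvPolynomial.aeval (R := K) x).restrictScalars k)
        ((D.free φ σ).toAlgHom (MvPolynomial.rename (fun s => (s, 0)) f)) := by
  induction f using MvPolynomial.induction_on with
  | C r =>
    rw [MvPolynomial.eval₂_C, MvPolynomial.rename_C]
    exact (D.map_aeval_freeCoaction_C φ x r).symm
  | add f g hf hg => rw [MvPolynomial.eval₂_add, hf, hg, map_add, map_add, map_add]
  | mul_X f q hf =>
    rw [MvPolynomial.eval₂_mul, hf, map_mul, map_mul, map_mul, MvPolynomial.eval₂_X, toAlgHom_free,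
      MvPolynomial.rename_X, freeCoaction_X, map_sum_gMon_tmul]
    simp [dPoint, structConst_zero_left]

/-- `c_V(W) ⊆ ∇ W` says that the ideal of `W` is stable under the operators of the free
`𝔤`-ring. -/
theorem cMap_image_subset_nabla_iff (W : Set (σ × MultiIdx e (p ^ m) → Ω)) :
    cMap φ '' W ⊆ D.nabla φ W ↔ ∀ f ∈ MvPolynomial.vanishingIdeal K W, ∀ i,
      (D.free φ σ).op φ i f ∈ MvPolynomial.vanishingIdeal K W := by
  have key (x : σ × MultiIdx e (p ^ m) → Ω) : cMap φ x ∈ D.nabla φ W ↔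
      ∀ f ∈ MvPolynomial.vanishingIdeal K W, ∀ i,
        MvPolynomial.aeval x ((D.free φ σ).op φ i f) = 0 :=
    forall₂_congr fun f _ => by
      rw [eval₂_dPoint_cMap, map_eq_zero_iff_tensorCoord φ]
      rfl
  rw [Set.image_subset_iff]
  exact ⟨fun h f hf i x hx => (key x).1 (h hx) f hf i,
    fun h x hx => (key x).2 fun f hf i => h f hf i x hx⟩

theorem subset_nabla_iff (V : Set (σ → Ω)) (W : Set (σ × MultiIdx e (p ^ m) → Ω)) :
    W ⊆ D.nabla φ V ↔ ∀ f ∈ MvPolynomial.vanishingIdeal K V, ∀ i,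
      (D.free φ σ).op φ i (MvPolynomial.rename (fun s => (s, 0)) f) ∈
        MvPolynomial.vanishingIdeal K W := by
  have key (x : σ × MultiIdx e (p ^ m) → Ω) : x ∈ D.nabla φ V ↔
      ∀ f ∈ MvPolynomial.vanishingIdeal K V, ∀ i, MvPolynomial.aeval x
        ((D.free φ σ).op φ i (MvPolynomial.rename (fun s => (s, 0)) f)) = 0 :=
    forall₂_congr fun f _ => by
      rw [eval₂_dPoint, map_eq_zero_iff_tensorCoord φ]
      rfl
  exact ⟨fun h f hf i x hx => (key x).1 (h hx) f hf i,
    fun h x hx => (key x).2 fun f hf i => h f hf i x hx⟩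

end Prolongation

theorem mem_vanishingIdeal_nablaProj_image {K Ω σ : Type*} {e N : ℕ} [NeZero N] [Field K] [Field Ω]
    [Algebra K Ω] (W : Set (σ × MultiIdx e N → Ω)) (f : MvPolynomial σ K) :
    f ∈ MvPolynomial.vanishingIdeal K (nablaProj '' W) ↔
      MvPolynomial.rename (fun s => (s, (0 : MultiIdx e N))) f ∈
        MvPolynomial.vanishingIdeal K W := by
  simp only [MvPolynomial.mem_vanishingIdeal_iff, Set.forall_mem_image, MvPolynomial.aeval_rename]
  rfl

end GDerivation

/-! ### Quantifier-free formulas -/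

namespace GDerivation

section Formulas

open FirstOrder Language

variable {k H : Type*} [CommRing k] [CommRing H] [HopfAlgebra k H] {e N : ℕ}
  (φ : H ≃ₐ[k] TruncPoly k e N)
  {A M M' : Type*} [CommRing A] [Algebra k A] [CommRing M] [Algebra k M] [CommRing M']
  [Algebra k M']
  {DA : GDerivation k H A} {D : GDerivation k H M} {D' : GDerivation k H M'}

theorem IsHom.realize_term {f : A →ₐ[k] M} (hf : IsHom DA D f) {α : Type*}
    (t : (hsLanguage k (MultiIdx e N)).Term α) (v : α → A) :
    @Term.realize _ M (D.toStructure φ) _ (f ∘ v) t =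
      f (@Term.realize _ A (DA.toStructure φ) _ v t) := by
  let _ := DA.toStructure φ
  let _ := D.toStructure φ
  let F : A →[hsLanguage k (MultiIdx e N)] M :=
    { toFun := f
      map_fun' := fun {_} c x => by
        cases c with
        | zero => exact map_zero f
        | one => exact map_one f
        | const c => exact f.commutes c
        | neg => exact map_neg f _
        | op i => exact (hf.map_op φ i _).symm
        | add => exact map_add f _ _
        | mul => exact map_mul f _ _
      map_rel' := fun {_} r => nomatch r }
  exact HomClass.realize_term F

/-- The truth of a quantifier-free formula under a morphism `h` of `𝔤`-rings only depends on which
elements of a finite set are annihilated by `h`. -/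
theorem exists_finset_realize_iff {f : A →ₐ[k] M} (hf : IsHom DA D f) {α : Type*} {n : ℕ}
    {ψ : (hsLanguage k (MultiIdx e N)).BoundedFormula α n} (hψ : ψ.IsQF) (v : α → A)
    (w : Fin n → A) :
    ∃ S : Finset A, ∀ h : A →ₐ[k] M', IsHom DA D' h → (∀ a ∈ S, h a = 0 ↔ f a = 0) →
      (@BoundedFormula.Realize _ M' (D'.toStructure φ) _ _ ψ (h ∘ v) (h ∘ w) ↔
        @BoundedFormula.Realize _ M (D.toStructure φ) _ _ ψ (f ∘ v) (f ∘ w)) := by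
  classical
  induction hψ with
  | falsum => exact ⟨∅, fun _ _ _ => Iff.rfl⟩
  | of_isAtomic hat =>
    cases hat with
    | rel r => exact nomatch r
    | equal t₁ t₂ =>
      let _ := DA.toStructure φ
      let _ := D.toStructure φ
      let _ := D'.toStructure φ
      refine ⟨{t₁.realize (Sum.elim v w) - t₂.realize (Sum.elim v w)}, fun h hh hS => ?_⟩
      rw [BoundedFormula.realize_bdEqual, BoundedFormula.realize_bdEqual, ← Sum.comp_elim,
        ← Sum.comp_elim, hf.realize_term φ, hf.realize_term φ, hh.realize_term φ,
        hh.realize_term φ]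
      simpa [sub_eq_zero] using hS
  | imp _ _ ih₁ ih₂ =>
    obtain ⟨S₁, h₁⟩ := ih₁
    obtain ⟨S₂, h₂⟩ := ih₂
    refine ⟨S₁ ∪ S₂, fun h hh hS => ?_⟩
    have e₁ := h₁ h hh fun a ha => hS a (Finset.mem_union_left _ ha)
    have e₂ := h₂ h hh fun a ha => hS a (Finset.mem_union_right _ ha)
    simp only [BoundedFormula.Realize, e₁, e₂]

end Formulas

section FreeFormulas

open FirstOrder Language

variable {p m : ℕ} [Fact p.Prime] {k : Type*} [CommRing k] [CharP k p] [PerfectRing k p]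
  {H : Type*} [CommRing H] [HopfAlgebra k H] {e : ℕ} (φ : H ≃ₐ[k] TruncPoly k e (p ^ m))
  {K : Type*} [CommRing K] [Algebra k K] (D : GDerivation k H K) {σ : Type*}

/-- The generators of the free `𝔤`-ring over `K`: the elements of `K` and the `x_{s,0}`. -/
def freeGen : K ⊕ σ → MvPolynomial (σ × MultiIdx e (p ^ m)) K :=
  Sum.elim MvPolynomial.C fun s => MvPolynomial.X (s, 0)

/-- Every element of the free `𝔤`-ring is the value of a term at the generators. -/
theorem exists_term_realize_eq (f : MvPolynomial (σ × MultiIdx e (p ^ m)) K) :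
    ∃ t : (hsLanguage k (MultiIdx e (p ^ m))).Term (K ⊕ σ),
      @Term.realize _ _ ((D.free φ σ).toStructure φ) _ freeGen t = f := by
  induction f using MvPolynomial.induction_on with
  | C r => exact ⟨.var (.inl r), rfl⟩
  | add f g hf hg =>
    obtain ⟨t₁, rfl⟩ := hf
    obtain ⟨t₂, rfl⟩ := hg
    exact ⟨.func (HSFunc.add : HSFunc k _ 2) ![t₁, t₂], rfl⟩
  | mul_X f q hf =>
    obtain ⟨t, rfl⟩ := hf
    refine ⟨.func (HSFunc.mul : HSFunc k _ 2)
      ![t, .func (HSFunc.op q.2 : HSFunc k _ 1) ![.var (.inr q.1)] ], ?_⟩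
    rw [← D.free_op_X_zero φ q.1 q.2]
    rfl

/-- A finite system of polynomial equations and one inequation in the `D_i x_s` is a
quantifier-free formula. -/
theorem exists_formula_realize_iff (S : Finset (MvPolynomial (σ × MultiIdx e (p ^ m)) K))
    (g : MvPolynomial (σ × MultiIdx e (p ^ m)) K) :
    ∃ ψ : (hsLanguage k (MultiIdx e (p ^ m))).Formula (K ⊕ σ), ψ.IsQF ∧
      ∀ (M : Type u) [CommRing M] [Algebra k M] (D' : GDerivation k H M)
        (h : MvPolynomial (σ × MultiIdx e (p ^ m)) K →ₐ[k] M), IsHom (D.free φ σ) D' h →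
        (@Formula.Realize _ M (D'.toStructure φ) _ ψ (h ∘ freeGen) ↔
          (∀ f ∈ S, h f = 0) ∧ h g ≠ 0) := by
  classical
  obtain ⟨t₀, ht₀⟩ := D.exists_term_realize_eq φ (0 : MvPolynomial (σ × MultiIdx e (p ^ m)) K)
  have heq (f : MvPolynomial (σ × MultiIdx e (p ^ m)) K) :
      ∃ ψ : (hsLanguage k (MultiIdx e (p ^ m))).Formula (K ⊕ σ), ψ.IsQF ∧
      ∀ (M : Type u) [CommRing M] [Algebra k M] (D' : GDerivation k H M)
        (h : MvPolynomial (σ × MultiIdx e (p ^ m)) K →ₐ[k] M), IsHom (D.free φ σ) D' h →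
        (@Formula.Realize _ M (D'.toStructure φ) _ ψ (h ∘ freeGen) ↔ h f = 0) := by
    obtain ⟨t, ht⟩ := D.exists_term_realize_eq φ f
    refine ⟨t.equal t₀, (BoundedFormula.IsAtomic.equal _ _).isQF, fun M _ _ D' h hh => ?_⟩
    let _ := D'.toStructure φ
    rw [Formula.realize_equal, hh.realize_term φ, hh.realize_term φ, ht, ht₀, map_zero]
  induction S using Finset.induction_on with
  | empty =>
    obtain ⟨ψ, hqf, hψ⟩ := heq g
    refine ⟨ψ.not, hqf.not, fun M _ _ D' h hh => ?_⟩
    let _ := D'.toStructure φ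
    rw [Formula.realize_not, hψ M D' h hh]
    simp
  | insert f S _ ih =>
    obtain ⟨ψ, hqf, hψ⟩ := heq f
    obtain ⟨ψ', hqf', hψ'⟩ := ih
    refine ⟨ψ ⊓ ψ', hqf.inf hqf', fun M _ _ D' h hh => ?_⟩
    let _ := D'.toStructure φ
    rw [Formula.realize_inf, hψ M D' h hh, hψ' M D' h hh]
    simp [and_assoc]

end FreeFormulas

end GDerivation

/-! ### Existentially closed `𝔤`-fields and the geometric axioms -/

namespace GDerivation

section Eval

variable {k : Type*} [CommRing k] {H : Type*} [CommRing H] [HopfAlgebra k H] {e N : ℕ}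
  (φ : H ≃ₐ[k] TruncPoly k e N) {K : Type*} [Field K]

theorem algebraMap_evalFree [Algebra k K] (D : GDerivation k H K) {Ω σ : Type*} [Field Ω]
    [Algebra K Ω] (a : σ → K)
    (f : MvPolynomial (σ × MultiIdx e N) K) :
    MvPolynomial.aeval (algebraMap K Ω ∘ D.dMap φ a) f =
      algebraMap K Ω (evalFree (R := K) φ D a f) :=
  MvPolynomial.aeval_algebraMap_apply Ω (D.dMap φ a) f

end Eval

section Eval

variable {p m : ℕ} [Fact p.Prime] {k : Type*} [CommRing k] [CharP k p] [PerfectRing k p]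
  {H : Type*} [CommRing H] [HopfAlgebra k H] {e : ℕ} (φ : H ≃ₐ[k] TruncPoly k e (p ^ m))

theorem evalFree_comp_freeGen {K : Type*} [CommRing K] {L : Type*} [CommRing L] [Algebra k L]
    [Algebra K L] {σ : Type*}
    (D' : GDerivation k H L) (b : σ → L) :
    ⇑(evalFree (R := K) φ D' b) ∘ freeGen = Sum.elim (algebraMap K L) b := by
  funext q
  rcases q with r | s
  · simp [freeGen, evalFree]
  · simp [freeGen, evalFree_X]

end Eval

section Main

variable {p m : ℕ} [Fact p.Prime] {k : Type*} [CommRing k] [CharP k p] [PerfectRing k p]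
  {H : Type*} [CommRing H] [HopfAlgebra k H] {e : ℕ} (φ : H ≃ₐ[k] TruncPoly k e (p ^ m))
  {K : Type u} [Field K] [Algebra k K] {D : GDerivation k H K}

theorem isHom_toAlgHom_self (D : GDerivation k H K) : IsHom D D (IsScalarTower.toAlgHom k K K) := by
  intro r
  have h : IsScalarTower.toAlgHom k K K = AlgHom.id k K := rfl
  rw [h, Algebra.TensorProduct.map_id]
  rfl

/-- Under the geometric axioms, the polynomial equations and inequations between the `D_i b_s` for a
tuple `b` in a `𝔤`-field extension `L` can be matched by a tuple in `K`, finitely many at a time.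
The axioms are applied to the loci `V` of `b` and `W` of `(D_i b_s)_{s,i}` over `K`. -/
theorem GeometricAxioms.exists_evalFree_eq_zero_iff (hD : D.GeometricAxioms φ) {L : Type*}
    [Field L] [Algebra k L] [Algebra K L] [IsScalarTower k K L] {D' : GDerivation k H L}
    (hext : IsHom D D' (IsScalarTower.toAlgHom k K L)) {n : ℕ} (b : Fin n → L)
    (S : Finset (MvPolynomial (Fin n × MultiIdx e (p ^ m)) K)) :
    ∃ a : Fin n → K, ∀ f ∈ S,
      evalFree (R := K) φ D a f = 0 ↔ evalFree (R := K) φ D' b f = 0 := by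
  classical
  rcases Nat.eq_zero_or_pos n with rfl | hn
  · -- The axioms say nothing about `𝔸^0`, but then the polynomials are constants.
    refine ⟨Fin.elim0, fun f _ => ?_⟩
    have h1 : evalFree (R := K) φ D' b f = algebraMap K L (evalFree φ D Fin.elim0 f) := by
      rw [← algebraMap_evalFree, evalFree]
      congr 2
      funext q
      exact q.1.elim0
    rw [h1, map_eq_zero_iff _ (algebraMap K L).injective]
  let Ω := AlgebraicClosure K
  let P := RingHom.ker (evalFree (R := K) φ D' b)
  let Q := RingHom.ker (MvPolynomial.aeval (R := K) b)
  have hP : P.IsPrime := RingHom.ker_isPrime _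
  have hQ : Q.IsPrime := RingHom.ker_isPrime _
  have hIP : MvPolynomial.vanishingIdeal K (MvPolynomial.zeroLocus Ω P) = P :=
    MvPolynomial.IsPrime.vanishingIdeal_zeroLocus P
  have hIQ : MvPolynomial.vanishingIdeal K (MvPolynomial.zeroLocus Ω Q) = Q :=
    MvPolynomial.IsPrime.vanishingIdeal_zeroLocus Q
  have hstab : ∀ f ∈ P, ∀ i, (D.free φ (Fin n)).op φ i f ∈ P := fun f hf i => by
    have h := (isHom_evalFree φ hext b).map_op φ i f
    have hf' : (evalFree (R := K) φ D' b).restrictScalars k f = 0 := hf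
    rw [hf', op_eq_tensorCoord, map_zero, map_zero] at h
    exact h.symm
  have hrename (f : MvPolynomial (Fin n) K) :
      MvPolynomial.rename (fun s => (s, (0 : MultiIdx e (p ^ m)))) f ∈ P ↔ f ∈ Q := by
    rw [RingHom.mem_ker, RingHom.mem_ker, evalFree, MvPolynomial.aeval_rename]
    have : (fun q : Fin n × MultiIdx e (p ^ m) => D'.op φ q.2 (b q.1)) ∘ (fun s => (s, 0)) = b :=
      funext fun s => D'.op_zero φ (b s)
    rw [this]
  -- `g` cuts out the locus where one of the inequations fails.
  let g := ∏ f ∈ S with f ∉ P, f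
  have hg : g ∉ P := by
    intro h
    obtain ⟨f, hf, hfP⟩ := hP.prod_mem_iff.1 h
    exact (Finset.mem_filter.1 hf).2 hfP
  obtain ⟨a, -, haW, haZ⟩ := hD n hn (MvPolynomial.zeroLocus Ω Q) (MvPolynomial.zeroLocus Ω P)
    (MvPolynomial.zeroLocus Ω (P ⊔ Ideal.span {g})) (isKIrreducible_zeroLocus Q)
    (isKIrreducible_zeroLocus P)
    ((D.subset_nabla_iff φ _ _).2 fun f hf i => by
      rw [hIQ] at hf
      rw [hIP]
      exact hstab _ ((hrename f).2 hf) i)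
    ⟨_, rfl⟩
    ⟨MvPolynomial.zeroLocus_anti_mono le_sup_left, fun h => hg <| by
      rw [← hIP]
      exact fun x hx => h hx g (Ideal.mem_sup_right (Ideal.mem_span_singleton_self g))⟩
    (by
      have : MvPolynomial.vanishingIdeal K (nablaProj '' MvPolynomial.zeroLocus Ω P) = Q := by
        ext f
        rw [mem_vanishingIdeal_nablaProj_image, hIP, hrename]
      rw [kClosure, this])
    ((D.cMap_image_subset_nabla_iff φ _).2 fun f hf i => by
      rw [hIP] at hf ⊢
      exact hstab f hf i)
  have hPa : ∀ f ∈ P, evalFree (R := K) φ D a f = 0 := fun f hf => by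
    have := haW f hf
    rwa [algebraMap_evalFree, map_eq_zero] at this
  refine ⟨a, fun f hf => ⟨fun h => ?_, hPa f⟩⟩
  by_contra hfP
  refine haZ fun q hq => ?_
  have hga : evalFree (R := K) φ D a g = 0 := by
    rw [map_prod]
    exact Finset.prod_eq_zero (Finset.mem_filter.2 ⟨hf, hfP⟩) h
  have hle : P ⊔ Ideal.span {g} ≤ RingHom.ker (evalFree (R := K) φ D a) :=
    sup_le hPa ((Ideal.span_singleton_le_iff_mem _).2 hga)
  rw [algebraMap_evalFree, hle hq, map_zero]

theorem GeometricAxioms.isExistentiallyClosed (hD : D.GeometricAxioms φ) :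
    D.IsExistentiallyClosed φ := by
  intro L _ _ _ _ D' hext n ψ hψ ⟨b, hb⟩
  have hL := isHom_evalFree φ hext b
  obtain ⟨S, hS⟩ := exists_finset_realize_iff (D' := D) φ hL hψ freeGen Fin.elim0
  obtain ⟨a, ha⟩ := hD.exists_evalFree_eq_zero_iff φ hext b S
  have h := hS _ (isHom_evalFree φ D.isHom_toAlgHom_self a) ha
  refine ⟨a, ?_⟩
  have eK := evalFree_comp_freeGen φ (K := K) D a
  have eL := evalFree_comp_freeGen φ (K := K) D' b
  rw [AlgHom.coe_restrictScalars', AlgHom.coe_restrictScalars', eK, eL] at h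
  have hid : ⇑(algebraMap K K) = id := rfl
  rw [hid, Subsingleton.elim (_ ∘ Fin.elim0) default,
    Subsingleton.elim (_ ∘ Fin.elim0) default] at h
  exact h.2 hb

theorem IsExistentiallyClosed.geometricAxioms (hD : D.IsExistentiallyClosed φ) :
    D.GeometricAxioms φ := by
  intro n _ V W Z _ hW _ hZ hZW hproj hc
  let P := MvPolynomial.vanishingIdeal K W
  have hP : P.IsPrime := hW.isPrime_vanishingIdeal
  rw [cMap_image_subset_nabla_iff] at hc
  obtain ⟨D', hD'⟩ := (D.free φ (Fin n)).exists_isHom_fractionRing φ P hc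
  set A := MvPolynomial (Fin n × MultiIdx e (p ^ m)) K
  set L := FractionRing (A ⧸ P)
  set q : A →ₐ[k] L := (IsScalarTower.toAlgHom k (A ⧸ P) L).comp (Ideal.Quotient.mkₐ k P)
  have hq (f : A) : q f = 0 ↔ f ∈ P := by
    have : q f = algebraMap (A ⧸ P) L (Ideal.Quotient.mk P f) := rfl
    rw [this, FaithfulSMul.algebraMap_eq_zero_iff, Ideal.Quotient.eq_zero_iff_mem]
  have hext : D.IsExtension D' := fun r => IsHom.comp hD' (D.isHom_C φ (Fin n)) r
  obtain ⟨g, hgZ, hgW⟩ : ∃ g ∈ MvPolynomial.vanishingIdeal K Z, g ∉ P := by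
    by_contra! h
    refine hZW.2 ?_
    rw [← hW.1.zeroLocus_vanishingIdeal, ← hZ.zeroLocus_vanishingIdeal]
    exact MvPolynomial.zeroLocus_anti_mono h
  obtain ⟨S, hS⟩ := (isNoetherianRing_iff_ideal_fg A).1 inferInstance P
  obtain ⟨ψ, hqf, hψ⟩ := exists_formula_realize_iff.{u} φ D S g
  have hgen : ⇑q ∘ freeGen = Sum.elim (algebraMap K L) fun s => q (MvPolynomial.X (s, 0)) := by
    funext t
    rcases t with r | s <;> rfl
  obtain ⟨a, ha⟩ := hD L D' hext n ψ hqf ⟨fun s => q (MvPolynomial.X (s, 0)), by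
    rw [← hgen, hψ L D' q hD']
    exact ⟨fun f hf => (hq f).2 (hS ▸ Ideal.subset_span hf), fun h => hgW ((hq g).1 h)⟩⟩
  have eK := evalFree_comp_freeGen φ (K := K) D a
  have hid : ⇑(algebraMap K K) = id := rfl
  rw [hid] at eK
  rw [← eK] at ha
  obtain ⟨haS, hag⟩ := (hψ K D _ (isHom_evalFree φ D.isHom_toAlgHom_self a)).1 ha
  have haP : P ≤ RingHom.ker (evalFree (R := K) φ D a) := by
    rw [← hS]
    exact Ideal.span_le.2 haS
  have haW : algebraMap K (AlgebraicClosure K) ∘ D.dMap φ a ∈ W := by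
    rw [← hW.1.zeroLocus_vanishingIdeal]
    intro f hf
    rw [algebraMap_evalFree, haP hf, map_zero]
  refine ⟨a, ?_, haW, fun haZ => hag ?_⟩
  · rw [← hproj]
    refine MvPolynomial.zeroLocus_vanishingIdeal_le _ ⟨_, haW, ?_⟩
    funext s
    exact congrArg _ (D.op_zero φ (a s))
  · have := hgZ _ haZ
    rwa [algebraMap_evalFree, map_eq_zero] at this

end Main

end GDerivation

end

theorem theorem5p5 (p m e : ℕ) [Fact p.Prime] (hm : 0 < m) (he : 0 < e)
    {k : Type*} [CommRing k] [CharP k p] [PerfectRing k p]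
    {H : Type*} [CommRing H] [HopfAlgebra k H] (φ : H ≃ₐ[k] TruncPoly k e (p ^ m))
    {K : Type*} [Field K] [Algebra k K] (D : GDerivation k H K) :
    D.IsExistentiallyClosed φ ↔ D.GeometricAxioms φ :=
  ⟨GDerivation.IsExistentiallyClosed.geometricAxioms φ,
    GDerivation.GeometricAxioms.isExistentiallyClosed φ⟩
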